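/- **Setup.** Let $\Omega$ be a finite-dimensional Euclidean space with its Borel $\sigma$-algebra, and let two agents $i=1,2$ each choose an effort $a_i\in\{0,1\}$. Under the effort profile $\mathbf a=(a_1,a_2)$ the data $\omega\in\Omega$ have law $P_{\mathbf a}$ with a measurable, everywhere positive density $p_{\mathbf a}$. Agent $i$ has utility $u_i(w_i)-c_i a_i$ from a wage $w_i\ge 0$, where $c_i>0$ and $u_i:[0,\infty)\to\mathbb R$ is continuous with $u_i(0)=0$, and $u_i'>0$, $u_i''<0$ on $(0,\infty)$. Write $\mathbf 1=(1,1)$ and let $\mathbf Z=(Z_1,Z_2):\Omega\to\mathbb R^2$, $Z_i(\omega)=1-p_{a_i=0,a_{-i}=1}(\omega)/p_{\mathbf 1}(\omega)$. For measurable $A$ with $P_{\mathbf 1}(A)>0$ put $z_i(A)=\mathbf E[Z_i\mid A;\mathbf a=\mathbf 1]$. Fix an integer $K\ge 2$, $\mu>0$ and $h:\Delta^K\to\mathbb R_+$ on the set $\Delta^K$ of probability vectors of length $K$. A monitoring technology is a partition $\mathcal P=\{A_1,\dots,A_N\}$ of $\Omega$ into $N\le K$ measurable cells of positive measure; a wage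 scheme assigns to each cell $A$ a vector $(w_1(A),w_2(A))\ge 0$. The pair is feasible if $\sum_{A\in\mathcal P}P_{\mathbf 1}(A)\,u_i(w_i(A))\,z_i(A)\ge c_i$ for $i=1,2$. It is optimal if it minimizes $$\sum_{A\in\mathcal P}P_{\mathbf 1}(A)\,(w_1(A)+w_2(A))+\mu\,h\bigl(P_{\mathbf 1}(A_1),\dots,P_{\mathbf 1}(A_N),0,\dots,0\bigr)$$ among all feasible pairs; $\mathcal P$ is then called an optimal monitoring technology. A set $A\subset\Omega$ is $\mathbf Z$-convex if for all $\omega',\omega''\in A$ with $\mathbf Z(\omega')\ne\mathbf Z(\omega'')$ it contains every $\omega\in\Omega$ with $\mathbf Z(\omega)=(1-s)\mathbf Z(\omega')+s\mathbf Z(\omega'')$ for some $s\in(0,1)$. A convex polygon is a compact subset of $\mathbb R^2$ with nonempty interior that is an intersection of finitely many closed half-planes. **Theorem.** Assume that 1. $h$ is invariant under permutations of its arguments, and $h(0,\pi_2,\pi_3,\dots,\pi_K)<h(\pi_1',\pi_2',\pi_3,\dots,\pi_K)$ whenever both vectors lie in $\Delta^K$, $\pi_2,\pi_1',\pi_2'>0$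 and $\pi_2=\pi_1'+\pi_2'$; 2. $\mathbf Z(\Omega)$ is connected, and the law of $\mathbf Z$ under $P_{\mathbf 1}$ is atomless in the sense that it gives no mass to any straight line in $\mathbb R^2$ (in particular, to any point); 3. $\mathbf Z(\Omega)$ is compact and two-dimensional (that is, not contained in a line). Then, up to $P_{\mathbf 1}$-null sets, every optimal monitoring technology consists of $\mathbf Z$-convex cells that form convex polygons in $\mathbb R^2$. Precisely, if $\{A_1,\dots,A_N\}$ is an optimal monitoring technology, then there are a partition $\{B_1,\dots,B_N\}$ of $\Omega$ into measurable $\mathbf Z$-convex sets with $P_{\mathbf 1}(A_n\,\triangle\,B_n)=0$ for all $n$, and convex polygons $Q_1,\dots,Q_N\subset\mathbb R^2$ with pairwise disjoint interiors, such that $\mathbf Z^{-1}(\operatorname{int}Q_n)\subset B_n\subset\mathbf Z^{-1}(Q_n)$ for all $n$; moreover $A_n$ and $\mathbf Z^{-1}(Q_n)$ differ only by a $P_{\mathbf 1}$-null set. -/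

import Mathlib

open MeasureTheory

noncomputable section

namespace TwoAgent

/-- Performance data live in a finite-dimensional Euclidean space (with its Borel sigma-algebra). -/
abbrev Data (d : ℕ) : Type := EuclideanSpace ℝ (Fin d)

/-- Effort profiles of the two agents; `true` is high effort, `false` is low effort. -/
abbrev Effort : Type := Fin 2 → Bool

/-- Both agents exert high effort. -/
def high : Effort := fun _ => true

/-- Agent `i` shirks while the other agent exerts high effort. -/
def shirk (i : Fin 2) : Effort := Function.update high i false

/-- A utility function on `[0, ∞)`: `u 0 = 0`, `u' > 0`, `u'' < 0`. Derivatives are required at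
positive wages only, so that `u = √` (with infinite slope at `0`) is included; values of `u` at
negative numbers play no role. -/
structure IsUtility (u : ℝ → ℝ) : Prop where
  zero : u 0 = 0
  cont : ContinuousOn u (Set.Ici 0)
  diff : ∀ x, 0 < x → DifferentiableAt ℝ u x
  diff2 : ∀ x, 0 < x → DifferentiableAt ℝ (deriv u) x
  deriv_pos : ∀ x, 0 < x → 0 < deriv u x
  deriv2_neg : ∀ x, 0 < x → deriv (deriv u) x < 0

/-- The primitives of the two-agent moral hazard problem. -/
structure Model (d K : ℕ) where
  /-- the utility functions of the agents -/
  u : Fin 2 → ℝ → ℝ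
  u_utility : ∀ i, IsUtility (u i)
  /-- the costs of high effort (low effort is costless) -/
  c : Fin 2 → ℝ
  c_pos : ∀ i, 0 < c i
  /-- the probability densities of the performance data under each effort profile -/
  p : Effort → Data d → ℝ
  p_measurable : ∀ a, Measurable (p a)
  p_pos : ∀ a ω, 0 < p a ω
  p_lintegral : ∀ a, ∫⁻ ω, ENNReal.ofReal (p a ω) = 1
  /-- the weight of the monitoring cost -/
  μ : ℝ
  μ_pos : 0 < μ
  /-- the monitoring cost as a function of the distribution of the output signal; only its values
  on the simplex matter -/
  h : (Fin K → ℝ) → ℝ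
  h_nonneg : ∀ q ∈ stdSimplex ℝ (Fin K), 0 ≤ h q

namespace Model

variable {d K : ℕ} (M : Model d K)

/-- The distribution of the performance data under the effort profile `a`. -/
def P (a : Effort) : Measure (Data d) :=
  volume.withDensity fun ω => ENNReal.ofReal (M.p a ω)

/-- The vector of the `Z_i = 1 - p_{a_i = 0, a_{-i} = 1} / p_1`. -/
def Z (ω : Data d) : Fin 2 → ℝ := fun i => 1 - M.p (shirk i) ω / M.p high ω

/-- `z_i(A) = E[Z_i | A; a = 1]`. -/
def z (A : Set (Data d)) (i : Fin 2) : ℝ := ⨍ ω in A, M.Z ω i ∂(M.P high)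

/-- The cost function `h` is invariant under permutations, and it increases strictly when one
cell of positive probability is split into two cells of positive probability. -/
structure MonitoringCostAssumption (hK : 2 ≤ K) : Prop where
  symm : ∀ q ∈ stdSimplex ℝ (Fin K), ∀ σ : Equiv.Perm (Fin K), M.h (q ∘ σ) = M.h q
  split : ∀ q ∈ stdSimplex ℝ (Fin K), ∀ q' ∈ stdSimplex ℝ (Fin K),
    (∀ k : Fin K, 2 ≤ (k : ℕ) → q k = q' k) →
    q ⟨0, by omega⟩ = 0 → 0 < q ⟨1, by omega⟩ →
    0 < q' ⟨0, by omega⟩ → 0 < q' ⟨1, by omega⟩ →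
    q ⟨1, by omega⟩ = q' ⟨0, by omega⟩ + q' ⟨1, by omega⟩ →
    M.h q < M.h q'

/-- `Z` has a connected range, and under high effort its distribution in the plane has no
mass on any straight line (in particular, no point mass). -/
structure RegularAssumption : Prop where
  connected : IsConnected (Set.range M.Z)
  atomless : ∀ (a : Fin 2 → ℝ) (b : ℝ), a ≠ 0 →
    M.P high {ω | a 0 * M.Z ω 0 + a 1 * M.Z ω 1 = b} = 0

/-- `Z` has a compact two-dimensional range (the dimension is that of the affine hull). -/
structure CompactAssumption : Prop where
  compact : IsCompact (Set.range M.Z)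
  dim : Module.finrank ℝ (vectorSpan ℝ (Set.range M.Z)) = 2

/-- A monitoring technology: a partition of the data space into at most `K` measurable cells of
positive measure. -/
structure Technology where
  N : ℕ
  N_le : N ≤ K
  cell : Fin N → Set (Data d)
  measurable : ∀ n, MeasurableSet (cell n)
  pos : ∀ n, 0 < M.P high (cell n)
  disjoint : Pairwise fun m n => Disjoint (cell m) (cell n)
  cover : ⋃ n, cell n = Set.univ

variable {M}

/-- The vector `(P_a(A_1), …, P_a(A_N), 0, …, 0)`. -/
def Technology.signal (T : M.Technology) (a : Effort) : Fin K → ℝ :=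
  fun k => if hk : (k : ℕ) < T.N then (M.P a).real (T.cell ⟨k, hk⟩) else 0

/-- Incentive compatibility and limited liability, for both agents; `w n i` is the wage of agent
`i` in the cell `n`. -/
structure Technology.Feasible (T : M.Technology) (w : Fin T.N → Fin 2 → ℝ) : Prop where
  ic : ∀ i, M.c i ≤ ∑ n, (M.P high).real (T.cell n) * M.u i (w n i) * M.z (T.cell n) i
  ll : ∀ n i, 0 ≤ w n i

/-- The total implementation cost under high effort: expected wages plus monitoring cost. -/
def Technology.cost (T : M.Technology) (w : Fin T.N → Fin 2 → ℝ) : ℝ :=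
  ∑ n, (M.P high).real (T.cell n) * ∑ i, w n i + M.μ * M.h (T.signal high)

/-- The contract `(T, w)` is optimal among all contracts that induce high effort. -/
def Technology.OptimalContract (T : M.Technology) (w : Fin T.N → Fin 2 → ℝ) : Prop :=
  T.Feasible w ∧
    ∀ (T' : M.Technology) (w' : Fin T'.N → Fin 2 → ℝ), T'.Feasible w' → T.cost w ≤ T'.cost w'

/-- The technology `T` is part of an optimal contract. -/
def Technology.IsOptimal (T : M.Technology) : Prop := ∃ w, T.OptimalContract w

variable (M)

/-- `Z`-convexity of a set of data points. -/
def ZConvex (A : Set (Data d)) : Prop :=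
  ∀ ω' ∈ A, ∀ ω'' ∈ A, M.Z ω' ≠ M.Z ω'' →
    {ω | ∃ s ∈ Set.Ioo (0 : ℝ) 1, M.Z ω = (1 - s) • M.Z ω' + s • M.Z ω''} ⊆ A

end Model

/-- A convex polygon in the plane: a compact set with nonempty interior that is the intersection
of finitely many closed half-planes. -/
def IsConvexPolygon (Q : Set (Fin 2 → ℝ)) : Prop :=
  IsCompact Q ∧ (interior Q).Nonempty ∧
    ∃ (m : ℕ) (a : Fin m → Fin 2 → ℝ) (b : Fin m → ℝ), (∀ j, a j ≠ 0) ∧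
      Q = {x | ∀ j, a j 0 * x 0 + a j 1 * x 1 ≤ b j}

end TwoAgent

end

open MeasureTheory

noncomputable section

namespace TwoAgent

/-! A perturbation argument that leaves every cell probability unchanged. Each agent `i` has a cell
`k i` with a positive wage and a positive integral of `Z_i`; adjusting that wage relaxes or tightens
the incentive constraint at a marginal cost λ_i, the shadow price. Put β_n = (λ_i u_i(w_i(A_n)))_i.
Moving a small piece of data from A_m to A_n changes the constraints, valued at λ, by the integral
of (β_n - β_m)·Z over the piece.

Along a cycle of cells, pass on pieces of equal measure ε. Neither the cell probabilities nor the
monitoring cost `h` change, so the only first-order effect on cost is through the constraints,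
repaired by the wages in the cells `k i`. Let D(m,n) be the essential infimum of (β_m - β_n)·Z on
A_m. If D had a negative sum along a cycle, pieces chosen near the infima would make the exchange
profitable (`cycle_nonneg`). So D has no negative cycle, and shortest-path lengths give a potential
τ with τ_m ≤ D(m,n) + τ_n (`exists_potential`). This says that almost everywhere on A_m the affine
form β_m·Z - τ_m is the largest.

Two cells with the same wages could be merged, which strictly lowers `h` (`wage_ne`); hence the β_n
are distinct and ties lie on finitely many lines, which are null. The cells are therefore, up to
null sets, the maximality regions of finitely many affine functions. Since Z is bounded, these may
be cut off by a square, giving polygons. -/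

/-! ### Auxiliary facts: divisibility, potentials, essential infima, wage perturbation -/

/-- The image under `f` of the measure restricted to `E` has no atoms, so its distribution function
is continuous and the intermediate value theorem applies; `F` is a sublevel part of `E`. -/
theorem exists_subset_measureReal_eq {α : Type*} [MeasurableSpace α] (μ : Measure α)
    [IsFiniteMeasure μ] {f : α → ℝ} (hf : Measurable f) (hnull : ∀ t, μ {x | f x = t} = 0)
    {C : ℝ} (hC : ∀ x, |f x| ≤ C) {E : Set α} (hE : MeasurableSet E) {ε : ℝ} (hε : 0 ≤ ε)
    (hεE : ε ≤ μ.real E) : ∃ F ⊆ E, MeasurableSet F ∧ μ.real F = ε := by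
  set ν : Measure ℝ := (μ.restrict E).map f with hν
  have hνs : ∀ s, MeasurableSet s → ν.real s = μ.real (f ⁻¹' s ∩ E) := fun s hs => by
    rw [hν, map_measureReal_apply hf hs, measureReal_restrict_apply (hf hs)]
  have hna : NullSingletonClass ν := ⟨fun t => by
    rw [hν, Measure.map_apply hf (measurableSet_singleton t)]
    exact le_antisymm ((Measure.restrict_apply_le _ _).trans (hnull t).le) zero_le⟩
  have hcont : Continuous fun b => ∫ _ in (-C - 1)..b, (1 : ℝ) ∂ν :=
    intervalIntegral.continuous_primitive (fun a b => intervalIntegrable_const) _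
  -- The left endpoint lies strictly below the range of `f`, so the half-open interval up to `C`
  -- misses nothing.
  have hval : ∀ b, -C - 1 ≤ b →
      ∫ _ in (-C - 1)..b, (1 : ℝ) ∂ν = μ.real (f ⁻¹' Set.Ioc (-C - 1) b ∩ E) := fun b hb => by
    rw [intervalIntegral.integral_of_le hb, ← hνs _ measurableSet_Ioc]
    simp
  by_cases hα : Nonempty α
  swap
  · have hE0 : E = ∅ := by
      rw [not_nonempty_iff] at hα
      exact Set.eq_empty_of_isEmpty E
    subst hE0
    exact ⟨∅, le_rfl, hE, le_antisymm (by simpa using hε) hεE⟩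
  obtain ⟨x₀⟩ := hα
  have hC0 : 0 ≤ C := (abs_nonneg _).trans (hC x₀)
  have htop : μ.real (f ⁻¹' Set.Ioc (-C - 1) C ∩ E) = μ.real E := by
    congr 1
    ext x
    have := abs_le.1 (hC x)
    simp only [Set.mem_inter_iff, Set.mem_preimage, Set.mem_Ioc, and_iff_right_iff_imp]
    intro _
    constructor <;> linarith
  have hle : -C - 1 ≤ C := by linarith
  obtain ⟨b, hb, hbε⟩ := intermediate_value_Icc hle hcont.continuousOn
    (show ε ∈ Set.Icc _ _ by
      refine ⟨by simpa using hε, ?_⟩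
      exact hεE.trans ((hval _ hle).trans htop).ge)
  refine ⟨f ⁻¹' Set.Ioc (-C - 1) b ∩ E, Set.inter_subset_right,
    (hf measurableSet_Ioc).inter hE, ?_⟩
  rw [← hval b hb.1]
  exact hbε

/-- The sets `E j` may overlap, since a cycle may revisit a cell. The pieces are chosen one at a
time: removing one costs each remaining set at most `ε`, which the factor `k` allows for. -/
theorem exists_disjoint_subsets_measureReal_eq {α : Type*} [MeasurableSpace α] (μ : Measure α)
    [IsFiniteMeasure μ]
    (hdiv : ∀ E, MeasurableSet E → ∀ ε, 0 ≤ ε → ε ≤ μ.real E →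
      ∃ F ⊆ E, MeasurableSet F ∧ μ.real F = ε) {ε : ℝ} (hε : 0 ≤ ε) :
    ∀ (k : ℕ) (E : Fin k → Set α), (∀ j, MeasurableSet (E j)) → (∀ j, k * ε ≤ μ.real (E j)) →
      ∃ F : Fin k → Set α, (∀ j, F j ⊆ E j) ∧ (∀ j, MeasurableSet (F j)) ∧
        (∀ j, μ.real (F j) = ε) ∧ Pairwise fun i j => Disjoint (F i) (F j) := by
  intro k
  induction k with
  | zero => exact fun E _ _ => ⟨E, fun j => j.elim0, fun j => j.elim0, fun j => j.elim0,
      fun j => j.elim0⟩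
  | succ k ih =>
    intro E hE hεE
    have hkε : 0 ≤ (k : ℝ) * ε := by positivity
    obtain ⟨F₀, hF₀, hF₀m, hF₀ε⟩ := hdiv (E 0) (hE 0) ε hε (by
      have := hεE 0
      push_cast at this
      linarith)
    obtain ⟨F, hF, hFm, hFε, hFd⟩ := ih (fun j => E j.succ \ F₀) (fun j => (hE _).diff hF₀m)
      (fun j => by
        have h1 := hεE j.succ
        have h2 : μ.real (E j.succ) - μ.real F₀ ≤ μ.real (E j.succ \ F₀) :=
          le_measureReal_sdiff
        push_cast at h1
        linarith)
    refine ⟨Fin.cons F₀ F, ?_, ?_, ?_, ?_⟩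
    · intro j
      refine Fin.cases hF₀ (fun j => ?_) j
      exact (hF j).trans Set.sdiff_subset
    · intro j
      exact Fin.cases hF₀m hFm j
    · intro j
      exact Fin.cases hF₀ε hFε j
    · have key : ∀ j, Disjoint F₀ (F j) := fun j =>
        (Set.disjoint_sdiff_right (s := F₀) (t := E j.succ)).mono_right (hF j)
      intro i j
      refine Fin.cases ?_ (fun i => ?_) i <;> refine Fin.cases ?_ (fun j => ?_) j
      · exact fun h => absurd rfl h
      · exact fun _ => key j
      · exact fun _ => (key i).symm
      · exact fun h => hFd (i := i) (j := j) fun hij => h (congrArg Fin.succ hij)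

/-- A system of difference constraints without negative cycles has a solution. -/
theorem exists_potential {ι : Type*} (d : ι → ι → ℝ)
    (hd : ∀ (k : ℕ) (x : Fin (k + 1) → ι), 0 ≤ ∑ j, d (x j) (x (j + 1))) :
    ∃ τ : ι → ℝ, ∀ m n, τ m ≤ d m n + τ n := by
  rcases isEmpty_or_nonempty ι with hι | ⟨⟨o⟩⟩
  · exact ⟨fun _ => 0, fun m => hι.elim m⟩
  -- Addition in `Fin (k + 1)` wraps around; the last term is this closing edge.
  have hd' : ∀ (k : ℕ) (x : ℕ → ι),
      0 ≤ ∑ j ∈ Finset.range k, d (x j) (x (j + 1)) + d (x k) (x 0) := by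
    intro k x
    have h := hd k fun j => x j
    rw [Fin.sum_univ_castSucc] at h
    simp only [Fin.last_add_one, Fin.coeSucc_eq_succ] at h
    simpa [Finset.sum_range] using h
  -- Lengths of walks from `m` to a base point `o`. Closing a walk by the edge from `o` to `m`
  -- bounds them below; the potential is their infimum.
  let S : ι → Set ℝ := fun m =>
    {r | ∃ (k : ℕ) (x : ℕ → ι), x 0 = m ∧ x k = o ∧ r = ∑ j ∈ Finset.range k, d (x j) (x (j + 1))}
  have hS : ∀ m, BddBelow (S m) := by
    refine fun m => ⟨-d o m, ?_⟩
    rintro r ⟨k, x, h0, hk, rfl⟩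
    have := hd' k x
    rw [h0, hk] at this
    linarith
  have hne : ∀ m, (S m).Nonempty := fun m =>
    ⟨_, 1, fun j => if j = 0 then m else o, by simp, by simp, rfl⟩
  refine ⟨fun m => sInf (S m), fun m n => ?_⟩
  suffices h : sInf (S m) - d m n ≤ sInf (S n) by linarith
  refine le_csInf (hne n) ?_
  rintro r ⟨k, x, h0, hk, rfl⟩
  have : sInf (S m) ≤ ∑ j ∈ Finset.range k, d (x j) (x (j + 1)) + d m n := by
    refine csInf_le (hS m) ⟨k + 1, fun j => Nat.casesOn j m x, rfl, hk, ?_⟩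
    rw [Finset.sum_range_succ']
    simp [h0]
  linarith

theorem exists_essential_infimum {α : Type*} [MeasurableSpace α] (μ : Measure α)
    {E : Set α} (hE : MeasurableSet E) (hpos : 0 < μ E) {f : α → ℝ}
    {C : ℝ} (hC : ∀ x, |f x| ≤ C) :
    ∃ d : ℝ, (∀ᵐ x ∂μ, x ∈ E → d ≤ f x) ∧
      ∀ δ > 0, 0 < μ (E ∩ {x | f x < d + δ}) := by
  have hb : Filter.IsBoundedUnder (· ≥ ·) (ae (μ.restrict E)) f :=
    ⟨-C, by simpa using .of_forall fun x => (abs_le.1 (hC x)).1⟩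
  have hne : (ae (μ.restrict E)).NeBot := by
    rw [ae_neBot]
    simpa using hpos.ne'
  have hcb : Filter.IsCoboundedUnder (· ≥ ·) (ae (μ.restrict E)) f :=
    Filter.IsBoundedUnder.isCoboundedUnder_ge
      ⟨C, by simpa using .of_forall fun x => (abs_le.1 (hC x)).2⟩
  refine ⟨essInf f (μ.restrict E), (ae_restrict_iff' hE).1 (ae_essInf_le hb), fun δ hδ => ?_⟩
  rw [pos_iff_ne_zero]
  intro h0
  have : essInf f (μ.restrict E) + δ ≤ essInf f (μ.restrict E) := by
    refine le_essInf_of_ae_le _ ?_ hcb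
    refine (ae_restrict_iff' hE).2 ?_
    rw [ae_iff]
    convert h0 using 2
    ext x
    simp
  linarith

/-- The wage change -G/(u'I) offsets to first order a shift `G` of the incentive constraint. The
extra `η * ε` adds a slack of u'Iηε, which absorbs both the Taylor remainder of `u` and the effect
of replacing `I` by `I'`. The threshold `ε₀` is uniform in `G` and `I'`. -/
theorem exists_wage_adjustment {u : ℝ → ℝ} {w u' I C η : ℝ} (hw : 0 < w)
    (hu : HasDerivAt u u' w) (hu' : 0 < u') (hI : 0 < I) (hC : 0 ≤ C) (hη : 0 < η) :
    ∃ ε₀ > 0, ∀ ε, 0 < ε → ε ≤ ε₀ → ∀ G I', |G| ≤ C * ε → |I' - I| ≤ C * ε →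
      0 ≤ w + (-G / (u' * I) + η * ε) ∧
      0 ≤ G + (u (w + (-G / (u' * I) + η * ε)) - u w) * I' := by
  set α := u' * I with hα
  have hα0 : 0 < α := mul_pos hu' hI
  set D := C / α + η with hD
  have hD0 : 0 < D := by positivity
  set ρ := α * η / (2 * D * (I + C)) with hρ
  have hρ0 : 0 < ρ := by positivity
  have hlin := (hasDerivAt_iff_isLittleO.1 hu).def hρ0
  obtain ⟨r, hr, hball⟩ := Metric.eventually_nhds_iff.1 hlin
  -- The four bounds give, in turn: |I'| ≤ I + C; validity of the Taylor estimate; a nonnegative new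
  -- wage; and a quadratic error of at most half the slack. The choice of `ρ` keeps the remainder
  -- within the other half.
  refine ⟨min 1 (min (r / (2 * D)) (min (w / D) (α * η / (2 * (u' * D * (C + 1)))))),
    by positivity, ?_⟩
  intro ε hε hε₀ G I' hG hI'
  obtain ⟨hε1, hε2, hε3, hε4⟩ : ε ≤ 1 ∧ ε ≤ r / (2 * D) ∧ ε ≤ w / D ∧
      ε ≤ α * η / (2 * (u' * D * (C + 1))) := by simpa only [le_min_iff] using hε₀
  set y := -G / α + η * ε with hy
  have hyD : |y| ≤ D * ε := by
    calc |y| ≤ |-G / α| + |η * ε| := abs_add_le _ _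
      _ = |G| / α + η * ε := by
        rw [abs_div, abs_neg, abs_of_pos hα0, abs_of_pos (mul_pos hη hε)]
      _ ≤ C * ε / α + η * ε := by gcongr
      _ = D * ε := by rw [hD]; ring
  have hyr : |y| < r := by
    rw [le_div_iff₀ (by positivity)] at hε2
    nlinarith
  have hyw : |y| ≤ w := by
    rw [le_div_iff₀ hD0] at hε3
    linarith
  refine ⟨by linarith [neg_abs_le y], ?_⟩
  have hb := hball (y := w + y) (by simpa [Real.dist_eq] using hyr)
  simp only [add_sub_cancel_left, smul_eq_mul, Real.norm_eq_abs] at hb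
  set R := u (w + y) - u w - y * u' with hR
  have hRle : |R| ≤ ρ * (D * ε) := hb.trans (by gcongr)
  have hI'C : |I'| ≤ I + C := by
    have h1 := abs_le.1 hI'
    have : C * ε ≤ C := mul_le_of_le_one_right hC hε1
    rw [abs_le]
    constructor <;> linarith
  have e1 : |R * I'| ≤ α * η * ε / 2 := by
    calc |R * I'| = |R| * |I'| := abs_mul _ _
      _ ≤ ρ * (D * ε) * (I + C) := by gcongr
      _ = α * η * ε / 2 := by rw [hρ]; field_simp
  have e2 : |y * u' * (I' - I)| ≤ α * η * ε / 2 := by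
    calc |y * u' * (I' - I)| = |y| * u' * |I' - I| := by
          rw [abs_mul, abs_mul, abs_of_pos hu']
      _ ≤ D * ε * u' * (C * ε) := by gcongr
      _ = (u' * D * C) * ε * ε := by ring
      _ ≤ (u' * D * (C + 1)) * ε * ε := by gcongr; linarith
      _ ≤ α * η * ε / 2 := by
        rw [le_div_iff₀ (by positivity)] at hε4
        nlinarith
  have key : G + (u (w + y) - u w) * I' = α * η * ε + R * I' + y * u' * (I' - I) := by
    have : α * y = -G + α * η * ε := by rw [hy]; field_simp
    have h3 : u (w + y) - u w = R + y * u' := by rw [hR]; ring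
    rw [h3]
    have h4 : y * u' * I = -G + α * η * ε := by rw [← this, hα]; ring
    linear_combination h4
  rw [key]
  linarith [(abs_le.1 e1).1, (abs_le.1 e2).1]

theorem IsUtility.strictMonoOn {u : ℝ → ℝ} (hu : IsUtility u) : StrictMonoOn u (Set.Ici 0) :=
  strictMonoOn_of_deriv_pos (convex_Ici 0) hu.cont fun x hx =>
    hu.deriv_pos x (by simpa using hx)

/-! ### Integrals of Z and feasible contracts -/

namespace Model
variable {d K : ℕ} {M : Model d K}

instance isProbabilityMeasure_P (a : Effort) : IsProbabilityMeasure (M.P a) := ⟨by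
  rw [P, withDensity_apply _ MeasurableSet.univ, Measure.restrict_univ, M.p_lintegral]⟩

theorem measurable_Z_apply (i : Fin 2) : Measurable fun ω => M.Z ω i :=
  measurable_const.sub ((M.p_measurable _).div (M.p_measurable _))

theorem measurable_Z : Measurable M.Z := measurable_pi_lambda _ measurable_Z_apply

theorem CompactAssumption.exists_bound (hcomp : M.CompactAssumption) :
    ∃ C : ℝ, 0 < C ∧ ∀ ω i, |M.Z ω i| ≤ C := by
  obtain ⟨C, hC, h⟩ := hcomp.compact.isBounded.exists_pos_norm_le
  exact ⟨C, hC, fun ω i => (norm_le_pi_norm (M.Z ω) i).trans (h _ ⟨ω, rfl⟩)⟩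

theorem integrable_Z {C : ℝ} (hC : ∀ ω i, |M.Z ω i| ≤ C) (i : Fin 2) :
    Integrable (fun ω => M.Z ω i) (M.P high) :=
  Integrable.of_bound (measurable_Z_apply i).aestronglyMeasurable C (.of_forall fun ω => hC ω i)

theorem real_mul_z (A : Set (Data d)) (i : Fin 2) :
    (M.P high).real A * M.z A i = ∫ ω in A, M.Z ω i ∂(M.P high) :=
  measure_smul_setAverage _ (measure_ne_top _ _)

theorem RegularAssumption.exists_subset (hreg : M.RegularAssumption) {C : ℝ}
    (hC : ∀ ω i, |M.Z ω i| ≤ C) (E : Set (Data d)) (hE : MeasurableSet E) (ε : ℝ) (hε : 0 ≤ ε)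
    (hεE : ε ≤ (M.P high).real E) :
    ∃ F ⊆ E, MeasurableSet F ∧ (M.P high).real F = ε := by
  refine exists_subset_measureReal_eq _ (measurable_Z_apply 0) (fun t => ?_) (fun ω => hC ω 0)
    hE hε hεE
  simpa using hreg.atomless ![1, 0] t (fun h => by simpa using congrFun h 0)

theorem Technology.feasible_iff {T : M.Technology} {w : Fin T.N → Fin 2 → ℝ} :
    T.Feasible w ↔ (∀ i, M.c i ≤ ∑ n, M.u i (w n i) * ∫ ω in T.cell n, M.Z ω i ∂(M.P high)) ∧
      ∀ n i, 0 ≤ w n i := by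
  have : ∀ i, ∑ n, (M.P high).real (T.cell n) * M.u i (w n i) * M.z (T.cell n) i =
      ∑ n, M.u i (w n i) * ∫ ω in T.cell n, M.Z ω i ∂(M.P high) := fun i =>
    Finset.sum_congr rfl fun n _ => by rw [← real_mul_z]; ring
  constructor
  · exact fun h => ⟨fun i => (h.ic i).trans (this i).le, h.ll⟩
  · exact fun h => ⟨fun i => (h.1 i).trans (this i).ge, h.2⟩

/-- In a feasible contract every agent has a cell with a positive wage, on which the average of
`Z` is positive. -/
theorem Technology.Feasible.exists_pos {T : M.Technology} {w : Fin T.N → Fin 2 → ℝ}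
    (h : T.Feasible w) (i : Fin 2) :
    ∃ n, 0 < w n i ∧ 0 < ∫ ω in T.cell n, M.Z ω i ∂(M.P high) := by
  obtain ⟨hic, hll⟩ := feasible_iff.1 h
  obtain ⟨n, -, hn⟩ := Finset.exists_lt_of_sum_lt (s := Finset.univ) (f := fun _ => (0 : ℝ))
    (by simpa using (M.c_pos i).trans_le (hic i))
  have hu := M.u_utility i
  rcases (hll n i).eq_or_lt with h0 | h0
  · rw [← h0, hu.zero, zero_mul] at hn
    exact absurd hn (lt_irrefl _)
  · refine ⟨n, h0, ?_⟩
    have h1 : 0 < M.u i (w n i) := by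
      rw [← hu.zero]
      exact hu.strictMonoOn (Set.mem_Ici.2 le_rfl) (Set.mem_Ici.2 h0.le) h0
    exact pos_of_mul_pos_right hn h1.le

/-! ### Cyclic exchanges of data between cells -/

/-- Moving disjoint sets of equal measure between the cells along a permutation. -/
theorem Technology.exists_reassignment (T : M.Technology) {J : Type*} [Fintype J]
    (s t : J → Fin T.N) (σ : Equiv.Perm J) (hσ : ∀ j, t j = s (σ j))
    (F : J → Set (Data d)) (hFm : ∀ j, MeasurableSet (F j))
    (hFs : ∀ j, F j ⊆ T.cell (s j)) (hFd : Pairwise fun i j => Disjoint (F i) (F j)) {ε : ℝ}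
    (hFε : ∀ j, (M.P high).real (F j) = ε) :
    ∃ cell : Fin T.N → Set (Data d), (∀ n, MeasurableSet (cell n)) ∧
      (Pairwise fun m n => Disjoint (cell m) (cell n)) ∧ (⋃ n, cell n = Set.univ) ∧
      (∀ n, (M.P high).real (cell n) = (M.P high).real (T.cell n)) ∧
      ∀ g : Data d → ℝ, Integrable g (M.P high) → ∀ n,
        ∫ ω in cell n, g ω ∂(M.P high) = ∫ ω in T.cell n, g ω ∂(M.P high) +
          ∑ j, ((if t j = n then ∫ ω in F j, g ω ∂(M.P high) else 0) -
            if s j = n then ∫ ω in F j, g ω ∂(M.P high) else 0) := by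
  classical
  have hcell : ∀ {x m n}, x ∈ T.cell m → x ∈ T.cell n → m = n := fun {x m n} hm hn => by
    by_contra h
    exact Set.disjoint_left.1 (T.disjoint h) hm hn
  have hFj : ∀ {x i j}, x ∈ F i → x ∈ F j → i = j := fun {x i j} hi hj => by
    by_contra h
    exact Set.disjoint_left.1 (hFd h) hi hj
  set S : Fin T.N → Set (Data d) := fun n => ⋃ j ∈ Finset.univ.filter (fun j => s j = n), F j
    with hS
  set R : Fin T.N → Set (Data d) := fun n => ⋃ j ∈ Finset.univ.filter (fun j => t j = n), F j
    with hR
  have memS : ∀ {x n}, x ∈ S n ↔ ∃ j, s j = n ∧ x ∈ F j := by simp [hS]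
  have memR : ∀ {x n}, x ∈ R n ↔ ∃ j, t j = n ∧ x ∈ F j := by simp [hR]
  have hSm : ∀ n, MeasurableSet (S n) := fun n => Finset.measurableSet_biUnion _ fun j _ => hFm j
  have hRm : ∀ n, MeasurableSet (R n) := fun n => Finset.measurableSet_biUnion _ fun j _ => hFm j
  have hST : ∀ n, S n ⊆ T.cell n := by
    intro n x hx
    obtain ⟨j, rfl, hj⟩ := memS.1 hx
    exact hFs j hj
  have hdisj : ∀ n, Disjoint (T.cell n \ S n) (R n) := by
    refine fun n => Set.disjoint_left.2 fun x hx hxR => hx.2 ?_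
    obtain ⟨j, -, hj⟩ := memR.1 hxR
    exact memS.2 ⟨j, hcell (hFs j hj) hx.1, hj⟩
  have hint : ∀ g : Data d → ℝ, Integrable g (M.P high) → ∀ n,
      ∫ ω in (T.cell n \ S n) ∪ R n, g ω ∂(M.P high) = ∫ ω in T.cell n, g ω ∂(M.P high) +
        ∑ j, ((if t j = n then ∫ ω in F j, g ω ∂(M.P high) else 0) -
          if s j = n then ∫ ω in F j, g ω ∂(M.P high) else 0) := by
    intro g hg n
    rw [setIntegral_union (hdisj n) (hRm n) hg.integrableOn hg.integrableOn,
      setIntegral_sdiff (hSm n) hg.integrableOn (hST n),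
      integral_biUnion_finset _ (fun j _ => hFm j) (fun i _ j _ h => hFd h)
        (fun _ _ => hg.integrableOn),
      integral_biUnion_finset _ (fun j _ => hFm j) (fun i _ j _ h => hFd h)
        (fun _ _ => hg.integrableOn), Finset.sum_sub_distrib, Finset.sum_filter, Finset.sum_filter]
    ring
  refine ⟨fun n => (T.cell n \ S n) ∪ R n, fun n => ((T.measurable n).diff (hSm n)).union (hRm n),
    ?_, ?_, ?_, hint⟩
  · intro m n hmn
    refine Set.disjoint_left.2 ?_
    rintro x (⟨hx, hxS⟩ | hx) (⟨hy, hyS⟩ | hy)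
    · exact hmn (hcell hx hy)
    · obtain ⟨j, -, hj⟩ := memR.1 hy
      exact hxS (memS.2 ⟨j, hcell (hFs j hj) hx, hj⟩)
    · obtain ⟨j, -, hj⟩ := memR.1 hx
      exact hyS (memS.2 ⟨j, hcell (hFs j hj) hy, hj⟩)
    · obtain ⟨j, rfl, hj⟩ := memR.1 hx
      obtain ⟨j', rfl, hj'⟩ := memR.1 hy
      exact hmn (by rw [hFj hj hj'])
  · refine Set.eq_univ_of_forall fun x => ?_
    obtain ⟨n, hn⟩ := Set.mem_iUnion.1 (T.cover ▸ Set.mem_univ x : x ∈ ⋃ n, T.cell n)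
    by_cases hx : x ∈ S n
    · obtain ⟨j, -, hj⟩ := memS.1 hx
      exact Set.mem_iUnion.2 ⟨t j, Or.inr (memR.2 ⟨j, rfl, hj⟩)⟩
    · exact Set.mem_iUnion.2 ⟨n, Or.inl ⟨hn, hx⟩⟩
  · intro n
    -- The integral formula with integrand 1: as `t` is `s` composed with a permutation, each cell
    -- loses and receives equally many pieces of measure `ε`.
    have h := hint (fun _ => 1) (integrable_const _) n
    simp only [integral_const, smul_eq_mul, mul_one, measureReal_restrict_apply_univ, hFε] at h
    simp only [hσ] at h
    rw [h, Finset.sum_sub_distrib, Equiv.sum_comp σ fun j => if s j = n then ε else 0, sub_self,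
      add_zero]

/-- The marginal cost of relaxing the incentive constraint of agent `i` through the wage in the
cell `k i`. -/
def Technology.shadowPrice (T : M.Technology) (w : Fin T.N → Fin 2 → ℝ) (k : Fin 2 → Fin T.N)
    (i : Fin 2) : ℝ :=
  (M.P high).real (T.cell (k i)) /
    (deriv (M.u i) (w (k i) i) * ∫ ω in T.cell (k i), M.Z ω i ∂(M.P high))

theorem Technology.real_cell_pos (T : M.Technology) (n : Fin T.N) :
    0 < (M.P high).real (T.cell n) :=
  ENNReal.toReal_pos (T.pos n).ne' (measure_ne_top _ _)

theorem Technology.shadowPrice_pos (T : M.Technology) {w : Fin T.N → Fin 2 → ℝ}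
    {k : Fin 2 → Fin T.N} {i : Fin 2} (hw : 0 < w (k i) i)
    (hI : 0 < ∫ ω in T.cell (k i), M.Z ω i ∂(M.P high)) : 0 < T.shadowPrice w k i :=
  div_pos (T.real_cell_pos _) (mul_pos ((M.u_utility i).deriv_pos _ hw) hI)

/-- No cyclic exchange of data between the cells of an optimal contract is profitable. -/
theorem Technology.OptimalContract.cycle_nonneg {T : M.Technology} {w : Fin T.N → Fin 2 → ℝ}
    (hopt : T.OptimalContract w) (hreg : M.RegularAssumption) {C₀ : ℝ} (hC₀ : 0 < C₀)
    (hC : ∀ ω i, |M.Z ω i| ≤ C₀) {k : Fin 2 → Fin T.N} (hw : ∀ i, 0 < w (k i) i)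
    (hI : ∀ i, 0 < ∫ ω in T.cell (k i), M.Z ω i ∂(M.P high)) (D : Fin T.N → Fin T.N → ℝ)
    (hD : ∀ m n, ∀ δ > 0, 0 < M.P high (T.cell m ∩ {ω |
      ∑ i, T.shadowPrice w k i * (M.u i (w m i) - M.u i (w n i)) * M.Z ω i < D m n + δ}))
    (l : ℕ) (x : Fin (l + 1) → Fin T.N) : 0 ≤ ∑ j, D (x j) (x (j + 1)) := by
  by_contra! hneg
  set Λ := ∑ j, D (x j) (x (j + 1)) with hΛ
  have hL : (0 : ℝ) < l + 1 := by positivity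
  -- With this tolerance the total of the `D + δ` along the cycle is still `Λ / 2`, which is
  -- negative.
  set δ := -Λ / (2 * (l + 1)) with hδ
  have hδ0 : 0 < δ := div_pos (by linarith) (by positivity)
  set lam := T.shadowPrice w k with hlam
  set f : Fin (l + 1) → Data d → ℝ := fun j ω =>
    ∑ i, lam i * (M.u i (w (x j) i) - M.u i (w (x (j + 1)) i)) * M.Z ω i with hf
  have hfm : ∀ j, Measurable (f j) := fun j =>
    Finset.measurable_sum _ fun i _ => (measurable_Z_apply i).const_mul _
  set E : Fin (l + 1) → Set (Data d) := fun j =>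
    T.cell (x j) ∩ {ω | f j ω < D (x j) (x (j + 1)) + δ} with hE
  have hEm : ∀ j, MeasurableSet (E j) := fun j =>
    (T.measurable _).inter (measurableSet_lt (hfm j) measurable_const)
  have hEpos : ∀ j, 0 < (M.P high).real (E j) := fun j =>
    ENNReal.toReal_pos (hD _ _ δ hδ0).ne' (measure_ne_top _ _)
  set V := ∑ i, ∑ j : Fin (l + 1), |M.u i (w (x (j + 1)) i) - M.u i (w (x j) i)| with hV
  have hV0 : 0 ≤ V := Finset.sum_nonneg fun i _ => Finset.sum_nonneg fun j _ => abs_nonneg _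
  -- One constant for both perturbations: `V` controls the shift of the incentive constraints, and
  -- 2(l + 1) the change of the integral over `cell (k i)`, as each of the l + 1 pieces enters and
  -- leaves at most once.
  set C := C₀ * (V + 2 * (l + 1)) with hCdef
  have hC0 : 0 ≤ C := by positivity
  -- The slack for two agents costs at most 2ηε = -Λε/4, half of the gain -Λε/2.
  set η := -Λ / 8 with hη
  have hη0 : 0 < η := by linarith
  have hadj := fun i => exists_wage_adjustment (hw i)
    ((M.u_utility i).diff _ (hw i)).hasDerivAt ((M.u_utility i).deriv_pos _ (hw i)) (hI i) hC0 hη0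
  choose ε₀ hε₀ hadj using hadj
  obtain ⟨j₀, hj₀⟩ := Finite.exists_min fun j => (M.P high).real (E j)
  set ε := min (min (ε₀ 0) (ε₀ 1)) ((M.P high).real (E j₀) / (l + 1)) with hε
  have hε0 : 0 < ε := lt_min (lt_min (hε₀ 0) (hε₀ 1)) (div_pos (hEpos j₀) hL)
  have hεi : ∀ i, ε ≤ ε₀ i := by
    rw [Fin.forall_fin_two]
    exact ⟨(min_le_left _ _).trans (min_le_left _ _), (min_le_left _ _).trans (min_le_right _ _)⟩
  have hεE : ∀ j, ((l + 1 : ℕ) : ℝ) * ε ≤ (M.P high).real (E j) := by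
    intro j
    have : ε ≤ (M.P high).real (E j₀) / (l + 1) := min_le_right _ _
    rw [le_div_iff₀ hL] at this
    push_cast
    linarith [hj₀ j]
  obtain ⟨F, hFE, hFm, hFε, hFd⟩ := exists_disjoint_subsets_measureReal_eq (M.P high)
    (hreg.exists_subset hC) hε0.le (l + 1) E hEm hεE
  obtain ⟨cell, hcm, hcd, hcc, hcP, hcint⟩ := T.exists_reassignment x
    (fun j => x (j + 1)) (Equiv.addRight 1) (fun _ => rfl) F hFm (fun j => (hFE j).trans Set.inter_subset_left) hFd hFε
  have hZint := integrable_Z (M := M) hC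
  have hFZ : ∀ j i, |∫ ω in F j, M.Z ω i ∂(M.P high)| ≤ C₀ * ε := by
    intro j i
    rw [← hFε j]
    exact norm_setIntegral_le_of_norm_le_const (f := fun ω => M.Z ω i) (measure_lt_top _ _)
      fun ω _ => hC ω i
  set G : Fin 2 → ℝ := fun i => ∑ j, (M.u i (w (x (j + 1)) i) - M.u i (w (x j) i)) *
    ∫ ω in F j, M.Z ω i ∂(M.P high) with hG
  have hGle : ∀ i, |G i| ≤ C * ε := by
    intro i
    calc |G i| ≤ ∑ j, |(M.u i (w (x (j + 1)) i) - M.u i (w (x j) i)) *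
          ∫ ω in F j, M.Z ω i ∂(M.P high)| := Finset.abs_sum_le_sum_abs _ _
      _ ≤ ∑ j, |M.u i (w (x (j + 1)) i) - M.u i (w (x j) i)| * (C₀ * ε) := by
        refine Finset.sum_le_sum fun j _ => ?_
        rw [abs_mul]
        exact mul_le_mul_of_nonneg_left (hFZ j i) (abs_nonneg _)
      _ = (∑ j, |M.u i (w (x (j + 1)) i) - M.u i (w (x j) i)|) * (C₀ * ε) := by
        rw [Finset.sum_mul]
      _ ≤ (V + 2 * (l + 1)) * (C₀ * ε) := by
        gcongr
        refine le_trans ?_ (le_add_of_nonneg_right (by positivity))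
        exact Finset.single_le_sum
          (f := fun i => ∑ j, |M.u i (w (x (j + 1)) i) - M.u i (w (x j) i)|)
          (fun i _ => Finset.sum_nonneg fun j _ => abs_nonneg _) (Finset.mem_univ i)
      _ = C * ε := by rw [hCdef]; ring
  have hIle : ∀ i, |(∫ ω in cell (k i), M.Z ω i ∂(M.P high)) -
      ∫ ω in T.cell (k i), M.Z ω i ∂(M.P high)| ≤ C * ε := by
    intro i
    rw [hcint _ (hZint i), add_sub_cancel_left]
    calc _ ≤ ∑ j : Fin (l + 1), (C₀ * ε + C₀ * ε) := by
          refine (Finset.abs_sum_le_sum_abs _ _).trans (Finset.sum_le_sum fun j _ => ?_)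
          have h0 : 0 ≤ C₀ * ε := by positivity
          refine (abs_sub _ _).trans (add_le_add ?_ ?_)
          · split_ifs
            · exact hFZ j i
            · simpa using h0
          · split_ifs
            · exact hFZ j i
            · simpa using h0
      _ = C₀ * (2 * (l + 1)) * ε := by simp; ring
      _ ≤ C * ε := by
        rw [hCdef]
        gcongr
        linarith
  set y : Fin 2 → ℝ := fun i => -G i / (deriv (M.u i) (w (k i) i) *
    ∫ ω in T.cell (k i), M.Z ω i ∂(M.P high)) + η * ε with hy
  have hadj' := fun i => hadj i ε hε0 (hεi i) (G i) _ (hGle i) (hIle i)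
  let T' : M.Technology :=
    { N := T.N
      N_le := T.N_le
      cell := cell
      measurable := hcm
      pos := fun n => (ENNReal.toReal_pos_iff.1 ((T.real_cell_pos n).trans_eq (hcP n).symm)).1
      disjoint := hcd
      cover := hcc }
  let w' : Fin T'.N → Fin 2 → ℝ := fun n i => if n = k i then w n i + y i else w n i
  obtain ⟨hic, hll⟩ := feasible_iff.1 hopt.1
  have hfeas : T'.Feasible w' := by
    refine feasible_iff.2 ⟨fun i => ?_, fun n i => ?_⟩
    · have h1 : ∑ n, M.u i (w' n i) * ∫ ω in cell n, M.Z ω i ∂(M.P high) =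
          ∑ n, (M.u i (w n i) * ∫ ω in cell n, M.Z ω i ∂(M.P high)) +
            (M.u i (w (k i) i + y i) - M.u i (w (k i) i)) *
              ∫ ω in cell (k i), M.Z ω i ∂(M.P high) := by
        rw [← sub_eq_iff_eq_add', ← Finset.sum_sub_distrib, Finset.sum_eq_single (k i)]
        · simp only [w', if_true]
          ring
        · intro n _ hn
          simp only [w', if_neg hn, sub_self]
        · simp
      have h2 : ∑ n, (M.u i (w n i) * ∫ ω in cell n, M.Z ω i ∂(M.P high)) =
          ∑ n, (M.u i (w n i) * ∫ ω in T.cell n, M.Z ω i ∂(M.P high)) + G i := by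
        simp only [hcint _ (hZint i), mul_add, Finset.sum_add_distrib, Finset.mul_sum]
        rw [Finset.sum_comm]
        congr 1
        refine Finset.sum_congr rfl fun j _ => ?_
        simp only [mul_sub, Finset.sum_sub_distrib, mul_ite, mul_zero, Finset.sum_ite_eq,
          Finset.mem_univ, if_true, sub_mul]
      change M.c i ≤ ∑ n, M.u i (w' n i) * ∫ ω in cell n, M.Z ω i ∂(M.P high)
      rw [h1, h2]
      linarith [hic i, (hadj' i).2]
    · simp only [w']
      split_ifs with h
      · rw [h]
        exact (hadj' i).1
      · exact hll n i
  have hle := hopt.2 T' w' hfeas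
  have hsig : T'.signal high = T.signal high := by
    funext m
    unfold signal
    by_cases hm : (m : ℕ) < T.N
    · rw [dif_pos hm, dif_pos (show (m : ℕ) < T'.N from hm)]
      exact hcP _
    · rw [dif_neg hm, dif_neg (show ¬ (m : ℕ) < T'.N from hm)]
  have hwage : ∑ n, (M.P high).real (cell n) * ∑ i, w' n i =
      ∑ n, (M.P high).real (T.cell n) * ∑ i, w n i +
        ∑ i, (M.P high).real (T.cell (k i)) * y i := by
    simp only [hcP, Finset.mul_sum]
    rw [Finset.sum_comm, Finset.sum_comm (f := fun n i => (M.P high).real (T.cell n) * w n i),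
      ← Finset.sum_add_distrib]
    refine Finset.sum_congr rfl fun i _ => ?_
    rw [← sub_eq_iff_eq_add', ← Finset.sum_sub_distrib, Finset.sum_eq_single (k i)]
    · simp only [w', if_true]
      ring
    · intro n _ hn
      simp only [w', if_neg hn, sub_self]
    · simp
  -- The integrand `f j` is below `D + δ` on `F j`, so the shadow value of the exchange is at least
  -- -εΛ/2.
  have hgain : -(ε * (Λ / 2)) ≤ ∑ i, lam i * G i := by
    have h1 : ∑ i, lam i * G i = ∑ j, -∫ ω in F j, f j ω ∂(M.P high) := by
      simp only [hG, hf, Finset.mul_sum]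
      rw [Finset.sum_comm]
      refine Finset.sum_congr rfl fun j _ => ?_
      rw [integral_finsetSum _ fun i _ => ((hZint i).integrableOn.const_mul _),
        ← Finset.sum_neg_distrib]
      refine Finset.sum_congr rfl fun i _ => ?_
      rw [integral_const_mul]
      ring
    have h2 : ∀ j, ∫ ω in F j, f j ω ∂(M.P high) ≤ (D (x j) (x (j + 1)) + δ) * ε := by
      intro j
      have hfi : Integrable (f j) (M.P high) :=
        integrable_finsetSum _ fun i _ => (hZint i).const_mul _
      calc ∫ ω in F j, f j ω ∂(M.P high)
          ≤ ∫ ω in F j, (D (x j) (x (j + 1)) + δ) ∂(M.P high) :=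
            setIntegral_mono_on hfi.integrableOn (integrable_const _).integrableOn (hFm j)
              fun ω hω => (hFE j hω).2.le
        _ = _ := by simp [hFε, mul_comm]
    have h3 : ∑ j, (D (x j) (x (j + 1)) + δ) * ε = ε * (Λ / 2) := by
      rw [← Finset.sum_mul, Finset.sum_add_distrib, ← hΛ]
      simp only [Finset.sum_const, Finset.card_univ, Fintype.card_fin, nsmul_eq_mul]
      push_cast
      rw [hδ]
      field_simp
      ring
    rw [h1, Finset.sum_neg_distrib, ← h3]
    exact neg_le_neg (Finset.sum_le_sum fun j _ => h2 j)
  have hy_le : ∀ i, (M.P high).real (T.cell (k i)) * y i ≤ -(lam i * G i) + η * ε := by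
    intro i
    have h1 : (M.P high).real (T.cell (k i)) * y i =
        -(lam i * G i) + (M.P high).real (T.cell (k i)) * (η * ε) := by
      simp only [hy, hlam, shadowPrice]
      ring
    have h2 : (M.P high).real (T.cell (k i)) * (η * ε) ≤ 1 * (η * ε) := by
      gcongr
      exact measureReal_le_one
    linarith
  unfold cost at hle
  rw [hsig] at hle
  change _ ≤ ∑ n, (M.P high).real (cell n) * ∑ i, w' n i + _ at hle
  rw [hwage, Fin.sum_univ_two] at hle
  rw [Fin.sum_univ_two] at hgain
  have := hy_le 0
  have := hy_le 1
  have : η * ε = -(ε * Λ) / 8 := by rw [hη]; ring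
  nlinarith [mul_pos hε0 (neg_pos.2 hneg)]

/-! ### Merging cells that pay the same wages -/

/-- The splitting assumption concerns the first two slots only; symmetry of `h` carries `b` and `a`
there, with the emptied slot `b` in front. -/
theorem MonitoringCostAssumption.merge_lt {hK : 2 ≤ K} (hcost : M.MonitoringCostAssumption hK)
    {q : Fin K → ℝ} (hq : q ∈ stdSimplex ℝ (Fin K)) {a b : Fin K} (hab : a ≠ b) (ha : 0 < q a)
    (hb : 0 < q b) :
    (fun k => if k = b then 0 else if k = a then q a + q b else q k) ∈ stdSimplex ℝ (Fin K) ∧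
    M.h (fun k => if k = b then 0 else if k = a then q a + q b else q k) < M.h q := by
  set r : Fin K → ℝ := fun k => if k = b then 0 else if k = a then q a + q b else q k with hr
  have hrq : ∀ k, r k = q k + ((if k = a then q b else 0) - if k = b then q b else 0) := by
    intro k
    by_cases hkb : k = b
    · simp [hr, hkb, hab.symm]
    · by_cases hka : k = a
      · simp [hr, hka, hab]
      · simp [hr, hka, hkb]
  have hperm : ∀ (s : Fin K → ℝ) (σ : Equiv.Perm (Fin K)), s ∈ stdSimplex ℝ (Fin K) →
      s ∘ σ ∈ stdSimplex ℝ (Fin K) := fun s σ hs =>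
    ⟨fun k => hs.1 _, (Equiv.sum_comp σ s).trans hs.2⟩
  have hrs : r ∈ stdSimplex ℝ (Fin K) := by
    refine ⟨fun k => ?_, ?_⟩
    · simp only [hr]
      split_ifs
      · exact le_rfl
      · positivity
      · exact hq.1 k
    · simp only [hrq, Finset.sum_add_distrib, Finset.sum_sub_distrib, Finset.sum_ite_eq',
        Finset.mem_univ, if_true, sub_self, add_zero]
      exact hq.2
  obtain ⟨σ, hσ⟩ := Equiv.Perm.exists_extending_pair
    (![⟨0, by omega⟩, ⟨1, by omega⟩] : Fin 2 → Fin K) ![b, a]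
    (by intro i j; fin_cases i <;> fin_cases j <;> simp)
    (by intro i j; fin_cases i <;> fin_cases j <;> simp [hab, hab.symm])
  have h0 : σ ⟨0, by omega⟩ = b := hσ 0
  have h1 : σ ⟨1, by omega⟩ = a := hσ 1
  refine ⟨hrs, ?_⟩
  rw [← hcost.symm r hrs σ, ← hcost.symm q hq σ]
  refine hcost.split _ (hperm r σ hrs) _ (hperm q σ hq) (fun k hk => ?_) ?_ ?_ ?_ ?_ ?_
  · have hkb : σ k ≠ b := fun h => by
      rw [← h0, σ.apply_eq_iff_eq] at h
      simp [h] at hk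
    have hka : σ k ≠ a := fun h => by
      rw [← h1, σ.apply_eq_iff_eq] at h
      simp [h] at hk
    simp [hr, hka, hkb]
  · simp [hr, h0]
  · simp only [Function.comp, hr, h1, if_neg hab, if_true]
    positivity
  · simpa [h0] using hb
  · simpa [h1] using ha
  · simp only [Function.comp, hr, h1, h0, if_neg hab, if_true]
    ring

theorem Technology.signal_mem_stdSimplex (T : M.Technology) (a : Effort) :
    T.signal a ∈ stdSimplex ℝ (Fin K) := by
  refine ⟨fun k => ?_, ?_⟩
  · unfold signal
    split_ifs
    · exact measureReal_nonneg
    · exact le_rfl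
  · rw [← Fintype.sum_of_injective (Fin.castLE T.N_le) (Fin.castLE_injective _)
      (fun n => (M.P a).real (T.cell n))]
    · have h := measureReal_biUnion_finset (μ := M.P a) (s := Finset.univ) (f := T.cell)
        (fun m _ n _ hmn => T.disjoint hmn) (fun n _ => T.measurable n)
      simp only [Finset.mem_univ, Set.iUnion_true, T.cover, probReal_univ] at h
      exact h.symm
    · intro k hk
      refine dif_neg fun hkN => hk ⟨⟨k, hkN⟩, rfl⟩
    · intro n
      simp [signal]

/-- In an optimal contract different cells pay different wages. -/
theorem Technology.OptimalContract.wage_ne {hK : 2 ≤ K} (hcost : M.MonitoringCostAssumption hK)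
    {C : ℝ} (hC : ∀ ω i, |M.Z ω i| ≤ C) {T : M.Technology} {w : Fin T.N → Fin 2 → ℝ}
    (hopt : T.OptimalContract w) {m n : Fin T.N} (hmn : m ≠ n) : w m ≠ w n := by
  intro hw
  have hsimp := T.signal_mem_stdSimplex high
  have hpos := T.real_cell_pos
  obtain ⟨N, hN, cell, hm, hp, hd, hc⟩ := T
  obtain _ | N := N
  · exact m.elim0
  simp only at w m n hw hmn hpos
  obtain ⟨k₀, hk₀⟩ := Fin.exists_succAbove_eq hmn
  have hcond : ∀ k, n.succAbove k = m ↔ k = k₀ := fun k => by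
    rw [← hk₀, Fin.succAbove_right_inj]
  -- Index `n` is dropped and its cell is joined to cell `m`, which has index `k₀` in the shorter
  -- list.
  let c' : Fin N → Set (Data d) := fun k =>
    cell (n.succAbove k) ∪ if n.succAbove k = m then cell n else ∅
  have hdis : ∀ k, Disjoint (cell (n.succAbove k)) (if n.succAbove k = m then cell n else ∅) := by
    intro k
    split_ifs
    · exact hd (Fin.succAbove_ne n k)
    · exact Set.disjoint_empty _
  have hem : ∀ k, MeasurableSet (if n.succAbove k = m then cell n else ∅) := by
    intro k
    split_ifs
    · exact hm n
    · exact MeasurableSet.empty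
  have hint : ∀ g : Data d → ℝ, Integrable g (M.P high) → ∀ k,
      ∫ ω in c' k, g ω ∂(M.P high) = ∫ ω in cell (n.succAbove k), g ω ∂(M.P high) +
        if k = k₀ then ∫ ω in cell n, g ω ∂(M.P high) else 0 := by
    intro g hg k
    rw [setIntegral_union (hdis k) (hem k) hg.integrableOn hg.integrableOn]
    simp only [hcond]
    split_ifs <;> simp
  have hreal : ∀ k, (M.P high).real (c' k) = (M.P high).real (cell (n.succAbove k)) +
      if k = k₀ then (M.P high).real (cell n) else 0 := by
    intro k
    rw [measureReal_union (hdis k) (hem k)]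
    simp only [hcond]
    split_ifs <;> simp
  let T' : M.Technology :=
    { N := N
      N_le := by omega
      cell := c'
      measurable := fun k => (hm _).union (hem k)
      pos := fun k => (hp (n.succAbove k)).trans_le (measure_mono Set.subset_union_left)
      disjoint := by
        intro i j hij
        have hne : n.succAbove i ≠ n.succAbove j := fun h => hij (Fin.succAbove_right_injective h)
        refine Set.disjoint_union_left.2 ⟨Set.disjoint_union_right.2 ⟨hd hne, ?_⟩,
          Set.disjoint_union_right.2 ⟨?_, ?_⟩⟩
        · split_ifs
          · exact hd (Fin.succAbove_ne n i)
          · exact Set.disjoint_empty _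
        · split_ifs
          · exact hd (Fin.succAbove_ne n j).symm
          · exact Set.empty_disjoint _
        · split_ifs with h1 h2
          · exact absurd (h1.trans h2.symm) hne
          all_goals simp
      cover := by
        refine Set.eq_univ_of_forall fun ω => ?_
        obtain ⟨j, hj⟩ := Set.mem_iUnion.1 (hc ▸ Set.mem_univ ω : ω ∈ ⋃ n, cell n)
        by_cases hjn : j = n
        · refine Set.mem_iUnion.2 ⟨k₀, Or.inr ?_⟩
          rw [if_pos hk₀, ← hjn]
          exact hj
        · obtain ⟨k, rfl⟩ := Fin.exists_succAbove_eq hjn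
          exact Set.mem_iUnion.2 ⟨k, Or.inl hj⟩ }
  have hmerge : ∀ φ ψ : Fin (N + 1) → ℝ, φ m = φ n →
      ∑ k, φ (n.succAbove k) * (ψ (n.succAbove k) + if k = k₀ then ψ n else 0) =
        ∑ j, φ j * ψ j := by
    intro φ ψ hφ
    rw [Fin.sum_univ_succAbove _ n]
    simp only [mul_add, Finset.sum_add_distrib, mul_ite, mul_zero, Finset.sum_ite_eq',
      Finset.mem_univ, if_true, hk₀, hφ]
    ring
  obtain ⟨hic, hll⟩ := feasible_iff.1 hopt.1
  have hfeas : T'.Feasible fun k => w (n.succAbove k) := by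
    refine feasible_iff.2 ⟨fun i => (hic i).trans_eq ?_, fun k i => hll _ i⟩
    change _ = ∑ k, M.u i (w (n.succAbove k) i) * ∫ ω in c' k, M.Z ω i ∂(M.P high)
    simp only [hint _ (integrable_Z hC i)]
    exact (hmerge (fun j => M.u i (w j i)) (fun j => ∫ ω in cell j, M.Z ω i ∂(M.P high))
      (by simp only [hw])).symm
  have hle := hopt.2 T' _ hfeas
  set T : M.Technology := ⟨N + 1, hN, cell, hm, hp, hd, hc⟩ with hT
  have hwage : ∑ k, (M.P high).real (c' k) * ∑ i, w (n.succAbove k) i =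
      ∑ j, (M.P high).real (cell j) * ∑ i, w j i := by
    simp only [hreal]
    rw [Finset.sum_congr rfl fun k _ => mul_comm _ _, hmerge (fun j => ∑ i, w j i)
      (fun j => (M.P high).real (cell j)) (by simp only [hw])]
    exact Finset.sum_congr rfl fun k _ => mul_comm _ _
  set a : Fin K := Fin.castLE hN m with ha
  set b : Fin K := Fin.castLE hN n with hb
  have hsig : ∀ j : Fin (N + 1), T.signal high (Fin.castLE hN j) = (M.P high).real (cell j) :=
    fun j => dif_pos j.2
  have hab : a ≠ b := fun h => hmn (Fin.castLE_injective hN h)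
  obtain ⟨hrs, hlt⟩ := hcost.merge_lt hsimp hab (by rw [ha, hsig]; exact hpos m)
    (by rw [hb, hsig]; exact hpos n)
  have hNK : N ≤ K := by omega
  -- Dropping `n` shifts the later cells, so the new signal vector is the merged one only up to a
  -- permutation extending `succAbove`. The remaining slots are sent either to `b` or beyond the old
  -- cells, where the merged vector vanishes.
  obtain ⟨τ, hτ⟩ := Equiv.Perm.exists_extending_pair
    (fun k : Fin N => Fin.castLE hNK k)
    (fun k => Fin.castLE hN (n.succAbove k)) (Fin.castLE_injective hNK)
    (fun i j h => Fin.succAbove_right_injective (Fin.castLE_injective hN h))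
  have hnew : T'.signal high = (fun k => if k = b then 0 else
      if k = a then T.signal high a + T.signal high b else T.signal high k) ∘ τ := by
    funext k
    by_cases hk : (k : ℕ) < N
    · have hτk : τ k = Fin.castLE hN (n.succAbove ⟨k, hk⟩) := hτ ⟨k, hk⟩
      have h1 : T'.signal high k = (M.P high).real (c' ⟨k, hk⟩) := dif_pos hk
      have h2 : ∀ j, Fin.castLE hN (n.succAbove ⟨k, hk⟩) = Fin.castLE hN j ↔
        n.succAbove ⟨k, hk⟩ = j := fun j => (Fin.castLE_injective hN).eq_iff
      simp only [Function.comp, hτk]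
      have h3 : Fin.castLE hN (n.succAbove ⟨k, hk⟩) ≠ b := fun h =>
        Fin.succAbove_ne _ _ ((h2 n).1 h)
      rw [h1, hreal, if_neg h3]
      by_cases h4 : (⟨k, hk⟩ : Fin N) = k₀
      · rw [if_pos h4, h4, hk₀, if_pos ha.symm, ha, hb, hsig, hsig]
      · rw [if_neg h4, if_neg fun h => h4 ((hcond _).1 ((h2 m).1 h)), hsig, add_zero]
    · have h1 : T'.signal high k = 0 := dif_neg hk
      rw [h1]
      simp only [Function.comp]
      have h2 : (τ k : ℕ) < N + 1 → τ k = b := by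
        intro h
        by_contra hne
        have h3 : (⟨τ k, h⟩ : Fin (N + 1)) ≠ n := fun h4 => hne (by rw [hb, ← h4]; rfl)
        obtain ⟨k', hk'⟩ := Fin.exists_succAbove_eq h3
        have h5 : τ (Fin.castLE hNK k') = τ k := by
          rw [hτ k', hk']
          rfl
        rw [τ.apply_eq_iff_eq] at h5
        exact hk (h5 ▸ k'.2)
      by_cases h : (τ k : ℕ) < N + 1
      · rw [if_pos (h2 h)]
      · have h3 : ∀ j : Fin (N + 1), τ k ≠ Fin.castLE hN j := fun j hj => h (by
          rw [hj]
          exact j.2)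
        rw [if_neg (h3 n), if_neg (h3 m)]
        have h4 : T.signal high (τ k) = 0 := dif_neg h
        exact h4.symm
  unfold cost at hle
  rw [hnew, hcost.symm _ hrs τ] at hle
  change ∑ j, (M.P high).real (cell j) * ∑ i, w j i + _ ≤
    ∑ k, (M.P high).real (c' k) * ∑ i, w (n.succAbove k) i + _ at hle
  rw [hwage] at hle
  have := mul_lt_mul_of_pos_left hlt M.μ_pos
  linarith

end Model

/-! ### Maximality regions of affine functions -/

/-- An affine function on the plane, given by its gradient and the negative of its value at `0`. -/
def affineForm (β : Fin 2 → ℝ) (t : ℝ) (x : Fin 2 → ℝ) : ℝ := β 0 * x 0 + β 1 * x 1 - t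

theorem continuous_affineForm (β : Fin 2 → ℝ) (t : ℝ) : Continuous (affineForm β t) := by
  unfold affineForm
  fun_prop

theorem affineForm_combo (β : Fin 2 → ℝ) (t s : ℝ) (x y : Fin 2 → ℝ) :
    affineForm β t ((1 - s) • x + s • y) =
      (1 - s) * affineForm β t x + s * affineForm β t y := by
  simp only [affineForm, Pi.add_apply, Pi.smul_apply, smul_eq_mul]
  ring

theorem isConvexPolygon_of_finite {ι : Type*} [Finite ι] (a : ι → Fin 2 → ℝ) (b : ι → ℝ)
    (ha : ∀ j, a j ≠ 0) {Q : Set (Fin 2 → ℝ)} (hQ : Q = {x | ∀ j, a j 0 * x 0 + a j 1 * x 1 ≤ b j})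
    (hc : IsCompact Q) (hi : (interior Q).Nonempty) : IsConvexPolygon Q := by
  obtain ⟨m, ⟨e⟩⟩ := Finite.exists_equiv_fin ι
  refine ⟨hc, hi, m, a ∘ e.symm, b ∘ e.symm, fun j => ha _, ?_⟩
  rw [hQ]
  ext x
  exact e.symm.forall_congr_right.symm

/-- The part of the square `[-R, R]²` on which the `n`-th of finitely many affine functions is
maximal. -/
def maxRegion {N : ℕ} (β : Fin N → Fin 2 → ℝ) (τ : Fin N → ℝ) (R : ℝ) (n : Fin N) :
    Set (Fin 2 → ℝ) :=
  {x | (∀ m, affineForm (β m) (τ m) x ≤ affineForm (β n) (τ n) x) ∧ ∀ i, |x i| ≤ R}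

/-- The set on which `n` is the first index of a maximal affine function. -/
def firstMaxRegion {N : ℕ} (β : Fin N → Fin 2 → ℝ) (τ : Fin N → ℝ) (n : Fin N) :
    Set (Fin 2 → ℝ) :=
  {x | ∀ m, affineForm (β m) (τ m) x ≤ affineForm (β n) (τ n) x ∧
    (m < n → affineForm (β m) (τ m) x < affineForm (β n) (τ n) x)}

variable {N : ℕ} {β : Fin N → Fin 2 → ℝ} {τ : Fin N → ℝ} {R : ℝ}

/-- At a tie, a small step in the direction `β m - β n` stays in the region but puts the `m`-th
function strictly ahead, unless the gradients agree. -/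
theorem lt_of_mem_interior_maxRegion (hβ : Function.Injective β) {m n : Fin N} (hmn : m ≠ n)
    {x : Fin 2 → ℝ} (hx : x ∈ interior (maxRegion β τ R n)) :
    affineForm (β m) (τ m) x < affineForm (β n) (τ n) x := by
  refine lt_of_le_of_ne ((interior_subset hx).1 m) fun heq => ?_
  have hcont : Continuous fun t : ℝ => x + t • (β m - β n) := by fun_prop
  have hev : ∀ᶠ t in nhds (0 : ℝ), x + t • (β m - β n) ∈ interior (maxRegion β τ R n) :=
    hcont.continuousAt.eventually (by simpa using isOpen_interior.mem_nhds hx)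
  obtain ⟨t, ht, htpos⟩ := ((hev.filter_mono nhdsWithin_le_nhds).and
    (self_mem_nhdsWithin (a := (0 : ℝ)) (s := Set.Ioi 0))).exists
  have hle := (interior_subset ht).1 m
  have htpos : 0 < t := htpos
  simp only [affineForm, Pi.add_apply, Pi.smul_apply, Pi.sub_apply, smul_eq_mul] at hle heq
  have hsq : t * ((β m 0 - β n 0) ^ 2 + (β m 1 - β n 1) ^ 2) ≤ 0 := by nlinarith
  have hsq' : (β m 0 - β n 0) ^ 2 + (β m 1 - β n 1) ^ 2 ≤ 0 := nonpos_of_mul_nonpos_right hsq htpos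
  have h0 : β m 0 = β n 0 := by nlinarith [sq_nonneg (β m 0 - β n 0), sq_nonneg (β m 1 - β n 1)]
  have h1 : β m 1 = β n 1 := by nlinarith [sq_nonneg (β m 0 - β n 0), sq_nonneg (β m 1 - β n 1)]
  exact hmn (hβ (funext (Fin.forall_fin_two.2 ⟨h0, h1⟩)))

theorem mem_interior_maxRegion {n : Fin N} {x : Fin 2 → ℝ}
    (hx : ∀ m, m ≠ n → affineForm (β m) (τ m) x < affineForm (β n) (τ n) x)
    (hR : ∀ i, |x i| < R) : x ∈ interior (maxRegion β τ R n) := by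
  have hopen : IsOpen ((⋂ m : {m // m ≠ n},
      {x | affineForm (β m) (τ m) x < affineForm (β n) (τ n) x}) ∩
      ⋂ i : Fin 2, {x : Fin 2 → ℝ | |x i| < R}) :=
    (isOpen_iInter_of_finite fun m =>
      isOpen_lt (continuous_affineForm _ _) (continuous_affineForm _ _)).inter
    (isOpen_iInter_of_finite fun i => isOpen_lt (by fun_prop) continuous_const)
  refine interior_maximal ?_ hopen ⟨Set.mem_iInter.2 fun m => hx m m.2, Set.mem_iInter.2 hR⟩
  rintro y ⟨hy, hyR⟩
  rw [Set.mem_iInter] at hy hyR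
  refine ⟨fun m => ?_, fun i => (hyR i).le⟩
  by_cases hm : m = n
  · rw [hm]
  · exact (hy ⟨m, hm⟩).le

/-- The half-planes are the comparisons with `m ≠ n`, whose normals `β m - β n` are nonzero by
injectivity, and the four sides of the square. -/
theorem isConvexPolygon_maxRegion (hβ : Function.Injective β) (n : Fin N)
    (hi : (interior (maxRegion β τ R n)).Nonempty) : IsConvexPolygon (maxRegion β τ R n) := by
  have hclosed : IsClosed (maxRegion β τ R n) := by
    have : maxRegion β τ R n =
        (⋂ m, {x | affineForm (β m) (τ m) x ≤ affineForm (β n) (τ n) x}) ∩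
        ⋂ i : Fin 2, {x : Fin 2 → ℝ | |x i| ≤ R} := by
      ext x
      simp [maxRegion]
    rw [this]
    exact (isClosed_iInter fun m =>
        isClosed_le (continuous_affineForm _ _) (continuous_affineForm _ _)).inter
      (isClosed_iInter fun i => isClosed_le (by fun_prop) continuous_const)
  refine isConvexPolygon_of_finite (ι := {m // m ≠ n} ⊕ (Fin 2 × Bool))
    (Sum.elim (fun m => β m - β n) fun p => Pi.single p.1 (if p.2 then 1 else -1))
    (Sum.elim (fun m => τ m - τ n) fun _ => R) ?_ ?_ ?_ hi
  · rintro (m | ⟨i, s⟩)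
    · exact sub_ne_zero.2 fun h => m.2 (hβ h)
    · cases s <;> simp
  · ext x
    simp only [maxRegion, affineForm, Set.mem_ofPred_eq, Sum.forall, Sum.elim_inl, Sum.elim_inr,
      Prod.forall, Bool.forall_bool, Fin.forall_fin_two, Subtype.forall, Pi.sub_apply, abs_le]
    refine and_congr ⟨fun h m _ => by linarith [h m], fun h m => ?_⟩ ?_
    · by_cases hm : m = n
      · rw [hm]
      · linarith [h m hm]
    · simp [neg_le]
  · refine (isCompact_Icc (a := fun _ : Fin 2 => -R) (b := fun _ => R)).of_isClosed_subset
      hclosed fun x hx => ⟨fun i => (abs_le.1 (hx.2 i)).1, fun i => (abs_le.1 (hx.2 i)).2⟩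

theorem disjoint_firstMaxRegion {m n : Fin N} (hmn : m ≠ n) :
    Disjoint (firstMaxRegion β τ m) (firstMaxRegion β τ n) := by
  refine Set.disjoint_left.2 fun x hm hn => ?_
  rcases hmn.lt_or_gt with h | h
  · exact absurd ((hn m).2 h) (hm n).1.not_gt
  · exact absurd ((hm n).2 h) (hn m).1.not_gt

theorem exists_mem_firstMaxRegion [NeZero N] (x : Fin 2 → ℝ) : ∃ n, x ∈ firstMaxRegion β τ n := by
  classical
  set S := Finset.univ.filter fun n => ∀ m, affineForm (β m) (τ m) x ≤ affineForm (β n) (τ n) x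
    with hS
  have hne : S.Nonempty := by
    obtain ⟨n, hn⟩ := Finite.exists_max fun n => affineForm (β n) (τ n) x
    exact ⟨n, by simpa [hS] using hn⟩
  have hmin : ∀ m, affineForm (β m) (τ m) x ≤ affineForm (β (S.min' hne)) (τ (S.min' hne)) x :=
    (Finset.mem_filter.1 (S.min'_mem hne)).2
  refine ⟨S.min' hne, fun m => ⟨hmin m, fun hm => ?_⟩⟩
  by_contra! hge
  have : m ∈ S := Finset.mem_filter.2 ⟨Finset.mem_univ _, fun j => (hmin j).trans hge⟩
  exact absurd (S.min'_le m this) hm.not_ge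

theorem measurableSet_firstMaxRegion (n : Fin N) : MeasurableSet (firstMaxRegion β τ n) := by
  have : firstMaxRegion β τ n =
      ⋂ m, {x | affineForm (β m) (τ m) x ≤ affineForm (β n) (τ n) x ∧
        (m < n → affineForm (β m) (τ m) x < affineForm (β n) (τ n) x)} := by
    ext x
    simp [firstMaxRegion]
  rw [this]
  have hmeas : ∀ m, Measurable (affineForm (β m) (τ m)) := fun m =>
    (continuous_affineForm _ _).measurable
  refine MeasurableSet.iInter fun m => (measurableSet_le (hmeas m) (hmeas n)).inter ?_
  exact (MeasurableSet.const _).imp (measurableSet_lt (hmeas m) (hmeas n))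

/-- Both the weak and the strict comparisons survive convex combinations, so breaking ties by index
costs no convexity. -/
theorem Model.zConvex_preimage_firstMaxRegion {d K : ℕ} (M : Model d K) (n : Fin N) :
    M.ZConvex (M.Z ⁻¹' firstMaxRegion β τ n) := by
  rintro ω' h' ω'' h'' - ω ⟨s, ⟨hs0, hs1⟩, hs⟩ m
  have hs1' : 0 < 1 - s := by linarith
  rw [hs, affineForm_combo, affineForm_combo]
  refine ⟨add_le_add (mul_le_mul_of_nonneg_left (h' m).1 hs1'.le)
    (mul_le_mul_of_nonneg_left (h'' m).1 hs0.le), fun hm => ?_⟩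
  exact add_lt_add (mul_lt_mul_of_pos_left ((h' m).2 hm) hs1')
    (mul_lt_mul_of_pos_left ((h'' m).2 hm) hs0)

/-! ### From optimality to affine functions, and the main theorem -/

/-- The cells of an optimal contract are, up to null sets, the regions of maximality of affine
functions of `Z` with distinct gradients. -/
theorem Model.Technology.OptimalContract.exists_affineForm {d K : ℕ} {M : Model d K} {hK : 2 ≤ K}
    (hcost : M.MonitoringCostAssumption hK) (hreg : M.RegularAssumption) {C : ℝ} (hC0 : 0 < C)
    (hC : ∀ ω i, |M.Z ω i| ≤ C) {T : M.Technology} {w : Fin T.N → Fin 2 → ℝ}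
    (hopt : T.OptimalContract w) :
    ∃ (β : Fin T.N → Fin 2 → ℝ) (τ : Fin T.N → ℝ), Function.Injective β ∧
      ∀ᵐ ω ∂(M.P high), ∀ n, ω ∈ T.cell n → ∀ m,
        affineForm (β m) (τ m) (M.Z ω) ≤ affineForm (β n) (τ n) (M.Z ω) := by
  choose k hw hI using hopt.1.exists_pos
  have hlam : ∀ i, 0 < T.shadowPrice w k i := fun i => T.shadowPrice_pos (hw i) (hI i)
  have hD : ∀ m n, ∃ D : ℝ, (∀ᵐ ω ∂(M.P high), ω ∈ T.cell m →
      D ≤ ∑ i, T.shadowPrice w k i * (M.u i (w m i) - M.u i (w n i)) * M.Z ω i) ∧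
      ∀ δ > 0, 0 < M.P high (T.cell m ∩ {ω |
        ∑ i, T.shadowPrice w k i * (M.u i (w m i) - M.u i (w n i)) * M.Z ω i < D + δ}) := by
    refine fun m n => exists_essential_infimum _ (T.measurable m) (T.pos m)
      (C := ∑ i, |T.shadowPrice w k i * (M.u i (w m i) - M.u i (w n i))| * C) fun ω => ?_
    refine (Finset.abs_sum_le_sum_abs _ _).trans (Finset.sum_le_sum fun i _ => ?_)
    rw [abs_mul]
    exact mul_le_mul_of_nonneg_left (hC ω i) (abs_nonneg _)
  choose D hDle hDpos using hD
  obtain ⟨τ, hτ⟩ := exists_potential D (hopt.cycle_nonneg hreg hC0 hC hw hI D hDpos)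
  -- The gradients are shadow-priced utilities. Shadow prices are positive and `u` is strictly
  -- monotone, so equal gradients would force equal wages.
  refine ⟨fun n i => T.shadowPrice w k i * M.u i (w n i), τ, fun m n hmn => ?_, ?_⟩
  · by_contra hne
    refine hopt.wage_ne hcost hC hne (funext fun i => ?_)
    exact (M.u_utility i).strictMonoOn.injOn (hopt.1.ll m i) (hopt.1.ll n i)
      (mul_left_cancel₀ (hlam i).ne' (congrFun hmn i))
  · filter_upwards [ae_all_iff.2 fun m => ae_all_iff.2 (hDle m)] with ω hω n hn m
    have h1 := hω n m hn
    have h2 := hτ n m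
    rw [Fin.sum_univ_two] at h1
    simp only [affineForm]
    linarith

end TwoAgent

open TwoAgent in
theorem theorem3 {d K : ℕ} (hK : 2 ≤ K) (M : TwoAgent.Model d K)
    (hcost : M.MonitoringCostAssumption hK)
    (hreg : M.RegularAssumption)
    (hcomp : M.CompactAssumption)
    (T : M.Technology) (hT : T.IsOptimal) :
    ∃ (B : Fin T.N → Set (TwoAgent.Data d)) (Q : Fin T.N → Set (Fin 2 → ℝ)),
      (∀ n, MeasurableSet (B n)) ∧
      (∀ n, B n =ᵐ[M.P TwoAgent.high] T.cell n) ∧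
      (Pairwise fun m n => Disjoint (B m) (B n)) ∧
      (⋃ n, B n = Set.univ) ∧
      (∀ n, M.ZConvex (B n)) ∧
      (∀ n, TwoAgent.IsConvexPolygon (Q n)) ∧
      (Pairwise fun m n => Disjoint (interior (Q m)) (interior (Q n))) ∧
      (∀ n, M.Z ⁻¹' interior (Q n) ⊆ B n ∧ B n ⊆ M.Z ⁻¹' Q n) ∧
      (∀ n, T.cell n =ᵐ[M.P TwoAgent.high] M.Z ⁻¹' Q n) := by
  obtain ⟨w, hopt⟩ := hT
  obtain ⟨C, hC0, hC⟩ := hcomp.exists_bound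
  obtain ⟨β, τ, hβ, hmax⟩ := hopt.exists_affineForm hcost hreg hC0 hC
  have hcov : ∀ ω, ∃ n, ω ∈ T.cell n := fun ω =>
    Set.mem_iUnion.1 (T.cover ▸ Set.mem_univ ω : ω ∈ ⋃ n, T.cell n)
  have hN : NeZero T.N := ⟨fun h => (h ▸ (hcov 0).choose : Fin 0).elim0⟩
  -- A tie between two forms puts `Z ω` on a line with nonzero normal `β m - β n`.
  have hties : ∀ᵐ ω ∂(M.P high), ∀ m n, m ≠ n →
      affineForm (β m) (τ m) (M.Z ω) ≠ affineForm (β n) (τ n) (M.Z ω) := by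
    refine ae_all_iff.2 fun m => ae_all_iff.2 fun n => ?_
    by_cases hmn : m = n
    · simp [hmn]
    have h := hreg.atomless (β m - β n) (τ m - τ n) (sub_ne_zero.2 fun h => hmn (hβ h))
    filter_upwards [measure_eq_zero_iff_ae_notMem.1 h] with ω hω _ heq
    refine hω ?_
    simp only [affineForm] at heq
    simp only [Pi.sub_apply]
    linarith
  have hgood : ∀ᵐ ω ∂(M.P high), ∀ n, ω ∈ T.cell n → ∀ m, m ≠ n →
      affineForm (β m) (τ m) (M.Z ω) < affineForm (β n) (τ n) (M.Z ω) := by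
    filter_upwards [hmax, hties] with ω h1 h2 n hn m hmn
    exact lt_of_le_of_ne (h1 n hn m) (h2 m n hmn)
  -- The strict margin keeps the range of `Z` inside the open square, so the cut-off adds no
  -- constraint on the data.
  have hR : ∀ ω i, |M.Z ω i| < C + 1 := fun ω i => (hC ω i).trans_lt (lt_add_one C)
  have hsub : ∀ n, firstMaxRegion β τ n ⊆ {x | ∀ m, affineForm (β m) (τ m) x ≤
      affineForm (β n) (τ n) x} := fun n x hx m => (hx m).1
  have hBQ : ∀ n, M.Z ⁻¹' firstMaxRegion β τ n ⊆ M.Z ⁻¹' maxRegion β τ (C + 1) n :=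
    fun n ω hω => ⟨hsub n hω, fun i => (hR ω i).le⟩
  have hcell : ∀ᵐ ω ∂(M.P high), ∀ n,
      (ω ∈ T.cell n → M.Z ω ∈ firstMaxRegion β τ n) ∧
      (M.Z ω ∈ maxRegion β τ (C + 1) n → ω ∈ T.cell n) := by
    filter_upwards [hgood] with ω hω n
    refine ⟨fun hn m => ?_, fun hn => ?_⟩
    · by_cases hmn : m = n
      · simp [hmn]
      · exact ⟨(hω n hn m hmn).le, fun _ => hω n hn m hmn⟩
    · obtain ⟨l, hl⟩ := hcov ω
      by_cases hln : n = l
      · rwa [hln]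
      · exact absurd (hω l hl n hln) (hn.1 l).not_gt
  refine ⟨fun n => M.Z ⁻¹' firstMaxRegion β τ n, fun n => maxRegion β τ (C + 1) n,
    fun n => Model.measurable_Z (measurableSet_firstMaxRegion n), fun n => ?_,
    fun m n hmn => (disjoint_firstMaxRegion hmn).preimage _, ?_,
    M.zConvex_preimage_firstMaxRegion, fun n => ?_, fun m n hmn => ?_,
    fun n => ⟨fun ω hω m => ?_, hBQ n⟩, fun n => ?_⟩
  · refine Filter.eventuallyEq_set.2 ?_
    filter_upwards [hcell] with ω hω
    exact ⟨fun h => (hω n).2 (hBQ n h), (hω n).1⟩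
  · refine Set.eq_univ_of_forall fun ω => Set.mem_iUnion.2 ?_
    exact exists_mem_firstMaxRegion (M.Z ω)
  · refine isConvexPolygon_maxRegion hβ n ?_
    -- A cell of positive measure contains a point where its form wins strictly; its image under `Z`
    -- is interior to the polygon.
    obtain ⟨ω, hn, hω⟩ := ((frequently_ae_mem_iff.2 (T.pos n).ne').and_eventually hgood).exists
    exact ⟨M.Z ω, mem_interior_maxRegion (hω n hn) (hR ω)⟩
  · refine Set.disjoint_left.2 fun x hm hn => ?_
    exact lt_asymm (lt_of_mem_interior_maxRegion hβ hmn hn)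
      (lt_of_mem_interior_maxRegion hβ hmn.symm hm)
  · refine ⟨(interior_subset hω).1 m, fun hmn => ?_⟩
    exact lt_of_mem_interior_maxRegion hβ hmn.ne hω
  · refine Filter.eventuallyEq_set.2 ?_
    filter_upwards [hcell] with ω hω
    exact ⟨fun h => hBQ n ((hω n).1 h), (hω n).2⟩

end
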